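/- **Theorem (Monotonicity of channel mana).** All systems are finite-dimensional and are tensor products of qudits of odd prime dimension (the trivial one-dimensional system is allowed). For a qudit of odd prime dimension $d$ put $\omega=e^{2\pi i/d}$, $\tau=e^{(d+1)\pi i/d}$, $X|j\rangle=|j+1 \bmod d\rangle$, $Z|j\rangle=\omega^j|j\rangle$, and $T_{\boldsymbol u}=\tau^{-a_1a_2}Z^{a_1}X^{a_2}$ for $\boldsymbol u=(a_1,a_2)\in\mathbb Z_d\times\mathbb Z_d$. On a composite system the phase space is the product of the phase spaces and $T_{\boldsymbol u\oplus\boldsymbol v}=T_{\boldsymbol u}\otimes T_{\boldsymbol v}$. On a system $A$ of dimension $d_A$ put $A_A^{\boldsymbol 0}=\frac1{d_A}\sum_{\boldsymbol u}T_{\boldsymbol u}$ and $A_A^{\boldsymbol u}=T_{\boldsymbol u}A_A^{\boldsymbol 0}T_{\boldsymbol u}^\dagger$. The discrete Wigner function of an operator $Q$ on $A$ is $W_Q(\boldsymbol u)=\frac1{d_A}\operatorname{Tr}[A_A^{\boldsymbol u}Q]$, and that of a linear map $\mathcal N_{A\to B}$ on operators is $$W_{\mathcal N}(\boldsymbol v|\boldsymbol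 u)=\frac1{d_B}\operatorname{Tr}\big[A_B^{\boldsymbol v}\,\mathcal N(A_A^{\boldsymbol u})\big].$$ The mana of $\mathcal N$ is $\mathcal M(\mathcal N)=\log\max_{\boldsymbol u}\sum_{\boldsymbol v}|W_{\mathcal N}(\boldsymbol v|\boldsymbol u)|$, with $\log 0=-\infty$. A quantum channel is a completely positive trace-preserving linear map. A Hermiticity-preserving linear map $\Pi_{A\to B}$ is *completely positive Wigner preserving* (CPWP) if, for every system $R$, $\operatorname{id}_R\otimes\Pi$ takes every density operator on $RA$ with non-negative discrete Wigner function to a density operator on $RB$ with non-negative discrete Wigner function. A *superchannel* $\Xi_{(A\to B)\to(C\to D)}$ is a linear map from linear maps $A\to B$ to linear maps $C\to D$ (acting on operators) such that, for every finite-dimensional reference system $R$ and every quantum channel $\mathcal N_{RA\to RB}$, the map $(\operatorname{id}_R\otimes\Xi)(\mathcal N)_{RC\to RD}$ is a quantum channel, where $\operatorname{id}_R$ is the identity supermap. It is a *CPWP superchannel* if, moreover, for every system $R$ and every CPWP quantum channel $\mathcal N_{RA\to RB}$, the channel $(\operatorname{id}_R\otimes\Xi)(\mathcal N)$ is CPWP.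 Let $\Xi_{(A\to B)\to(C\to D)}$ be a CPWP superchannel. Then for every completely positive map $\mathcal N_{A\to B}$, trace preserving or not (in particular, for every quantum channel), $$\mathcal M(\mathcal N)\ \ge\ \mathcal M(\Xi(\mathcal N)).$$ -/

import Mathlib

open scoped ComplexOrder Kronecker

noncomputable section

/-- A finite-dimensional quantum system of odd dimension, presented as a tensor product of systems
of odd prime dimension. The empty tensor product, of dimension one, is `unit`. -/
inductive QSys : Type
  | unit : QSys
  | qudit (p : ℕ) (hp : p.Prime) (hodd : Odd p) : QSys
  | tensor (A B : QSys) : QSys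

namespace QSys

/-- Labels of the computational basis: `ZMod p` for a qudit of dimension `p`, and pairs for a
tensor product. -/
def Idx : QSys → Type
  | unit => Unit
  | qudit p _ _ => ZMod p
  | tensor A B => A.Idx × B.Idx

/-- The discrete phase space: `ZMod p × ZMod p` for a qudit of dimension `p`, and pairs of
phase-space points for a tensor product. -/
def Phase : QSys → Type
  | unit => Unit
  | qudit p _ _ => ZMod p × ZMod p
  | tensor A B => A.Phase × B.Phase

instance instFintypeIdx : (A : QSys) → Fintype A.Idx
  | unit => inferInstanceAs (Fintype Unit)
  | qudit p hp _ =>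
      haveI : NeZero p := ⟨hp.ne_zero⟩
      inferInstanceAs (Fintype (ZMod p))
  | tensor A B =>
      haveI := instFintypeIdx A
      haveI := instFintypeIdx B
      inferInstanceAs (Fintype (A.Idx × B.Idx))

instance instDecidableEqIdx : (A : QSys) → DecidableEq A.Idx
  | unit => inferInstanceAs (DecidableEq Unit)
  | qudit p _ _ => inferInstanceAs (DecidableEq (ZMod p))
  | tensor A B =>
      haveI := instDecidableEqIdx A
      haveI := instDecidableEqIdx B
      inferInstanceAs (DecidableEq (A.Idx × B.Idx))

instance instFintypePhase : (A : QSys) → Fintype A.Phase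
  | unit => inferInstanceAs (Fintype Unit)
  | qudit p hp _ =>
      haveI : NeZero p := ⟨hp.ne_zero⟩
      inferInstanceAs (Fintype (ZMod p × ZMod p))
  | tensor A B =>
      haveI := instFintypePhase A
      haveI := instFintypePhase B
      inferInstanceAs (Fintype (A.Phase × B.Phase))

/-- The origin of the phase space. -/
def origin : (A : QSys) → A.Phase
  | unit => ()
  | qudit p _ _ => ((0, 0) : ZMod p × ZMod p)
  | tensor A B => (A.origin, B.origin)

instance instNonemptyPhase (A : QSys) : Nonempty A.Phase := ⟨A.origin⟩

/-- The dimension of the Hilbert space. -/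
def dim (A : QSys) : ℕ := Fintype.card A.Idx

/-- Operators on the Hilbert space, as matrices in the computational basis. -/
abbrev Op (A : QSys) : Type := Matrix A.Idx A.Idx ℂ

end QSys

open QSys

/-! ### Heisenberg--Weyl and phase-space point operators -/

/-- The shift operator `X |j⟩ = |j + 1⟩`. -/
def shiftOp (p : ℕ) : Matrix (ZMod p) (ZMod p) ℂ :=
  Matrix.of fun k j => if k = j + 1 then 1 else 0

/-- The boost operator `Z |j⟩ = ω ^ j |j⟩`, with `ω = exp (2 π i / p)`. -/
def boostOp (p : ℕ) : Matrix (ZMod p) (ZMod p) ℂ :=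
  Matrix.diagonal fun j => Complex.exp (2 * Real.pi * Complex.I / p) ^ j.val

/-- The Heisenberg--Weyl operators: `τ ^ (-a₁ a₂) Z ^ a₁ X ^ a₂`, with `τ = exp ((p + 1) π i / p)`,
on a qudit of dimension `p`, and tensor products of these on a composite system. -/
def heisenbergWeyl : (A : QSys) → A.Phase → A.Op
  | unit => fun _ => (1 : Matrix Unit Unit ℂ)
  | qudit p hp _ => fun a : ZMod p × ZMod p =>
      haveI : NeZero p := ⟨hp.ne_zero⟩
      (Complex.exp ((p + 1) * Real.pi * Complex.I / p) ^ (-((a.1.val : ℤ) * (a.2.val : ℤ))) •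
        (boostOp p ^ a.1.val * shiftOp p ^ a.2.val) : Matrix (ZMod p) (ZMod p) ℂ)
  | tensor A B => fun u : A.Phase × B.Phase =>
      (heisenbergWeyl A u.1 ⊗ₖ heisenbergWeyl B u.2 :
        Matrix (A.Idx × B.Idx) (A.Idx × B.Idx) ℂ)

/-- The phase-space point operator at the origin, `(1 / d) ∑ u, T u`. -/
def phaseOpZero (A : QSys) : A.Op := (1 / (A.dim : ℂ)) • ∑ u : A.Phase, heisenbergWeyl A u

/-- The phase-space point operators `T u * A 0 * (T u)†`. -/
def phaseOp (A : QSys) (u : A.Phase) : A.Op :=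
  heisenbergWeyl A u * phaseOpZero A * (heisenbergWeyl A u).conjTranspose

/-- The discrete Wigner function `(1 / d) Tr[A u * X]`. It takes real values when `X` is
Hermitian. -/
def wigner (A : QSys) (X : A.Op) (u : A.Phase) : ℂ :=
  (1 / (A.dim : ℂ)) * (phaseOp A u * X).trace

/-- Membership in the Wigner polytope: density operators with non-negative discrete Wigner
function. The order on `ℂ` is the one in which `0 ≤ z` says that `z` is real and non-negative. -/
def IsWignerPositiveState (A : QSys) (ρ : A.Op) : Prop :=
  ρ.PosSemidef ∧ ρ.trace = 1 ∧ ∀ u, 0 ≤ wigner A ρ u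

/-! ### Maps, channels and supermaps -/

section Maps

variable {α β γ δ : Type}

/-- The block `⟨r|M|s⟩` of an operator `M` on a bipartite system. -/
def blockAt {ρ : Type} (M : Matrix (ρ × α) (ρ × α) ℂ) (r s : ρ) : Matrix α α ℂ :=
  Matrix.of fun a a' => M (r, a) (s, a')

/-- The map `id ⊗ Φ`, where the identity acts on the operators of a reference system with basis
labels `ρ`: it applies `Φ` to every block. -/
def idTensor (ρ : Type) (Φ : Matrix α α ℂ →ₗ[ℂ] Matrix β β ℂ) :
    Matrix (ρ × α) (ρ × α) ℂ →ₗ[ℂ] Matrix (ρ × β) (ρ × β) ℂ where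
  toFun M := Matrix.of fun x y => Φ (blockAt M x.1 y.1) x.2 y.2
  map_add' M M' := by
    ext x y
    have h : blockAt (M + M') x.1 y.1 = blockAt M x.1 y.1 + blockAt M' x.1 y.1 := rfl
    simp [h]
  map_smul' c M := by
    ext x y
    have h : blockAt (c • M) x.1 y.1 = c • blockAt M x.1 y.1 := rfl
    simp [h]

/-- Complete positivity: `id ⊗ Φ` preserves positive semidefiniteness for every finite-dimensional
reference system. -/
def IsCompletelyPositive (Φ : Matrix α α ℂ →ₗ[ℂ] Matrix β β ℂ) : Prop :=
  ∀ (n : ℕ) (M : Matrix (Fin n × α) (Fin n × α) ℂ),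
    M.PosSemidef → (idTensor (Fin n) Φ M).PosSemidef

/-- Trace preservation. -/
def IsTracePreserving [Fintype α] [Fintype β] (Φ : Matrix α α ℂ →ₗ[ℂ] Matrix β β ℂ) : Prop :=
  ∀ M, (Φ M).trace = M.trace

/-- A quantum channel is a completely positive and trace-preserving linear map. -/
def IsChannel [Fintype α] [Fintype β] (Φ : Matrix α α ℂ →ₗ[ℂ] Matrix β β ℂ) : Prop :=
  IsCompletelyPositive Φ ∧ IsTracePreserving Φ

/-- Preservation of Hermitian operators. -/
def IsHermiticityPreserving (Φ : Matrix α α ℂ →ₗ[ℂ] Matrix β β ℂ) : Prop :=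
  ∀ M : Matrix α α ℂ, M.IsHermitian → (Φ M).IsHermitian

variable {ρ : Type} [DecidableEq ρ]

/-- The component `X ↦ ⟨s|N(|r⟩⟨r'| ⊗ X)|s'⟩` of a bipartite map `N`, so that
`N (Y ⊗ X) = ∑ r r' s s', Y r r' • (|s⟩⟨s'| ⊗ mapSlice N r r' s s' X)`. -/
def mapSlice (N : Matrix (ρ × α) (ρ × α) ℂ →ₗ[ℂ] Matrix (ρ × β) (ρ × β) ℂ) (r r' s s' : ρ) :
    Matrix α α ℂ →ₗ[ℂ] Matrix β β ℂ where
  toFun X := blockAt (N (Matrix.single r r' (1 : ℂ) ⊗ₖ X)) s s'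
  map_add' X Y := by
    rw [Matrix.kronecker_add, map_add]
    rfl
  map_smul' c X := by
    rw [Matrix.kronecker_smul, map_smul]
    rfl

/-- The supermap `id ⊗ Ξ`, where `id` is the identity supermap on a reference system with basis
labels `ρ`: it applies `Ξ` to every component of a bipartite map. -/
def idTensorSuper [Fintype ρ]
    (Ξ : (Matrix α α ℂ →ₗ[ℂ] Matrix β β ℂ) →ₗ[ℂ] (Matrix γ γ ℂ →ₗ[ℂ] Matrix δ δ ℂ))
    (N : Matrix (ρ × α) (ρ × α) ℂ →ₗ[ℂ] Matrix (ρ × β) (ρ × β) ℂ) :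
    Matrix (ρ × γ) (ρ × γ) ℂ →ₗ[ℂ] Matrix (ρ × δ) (ρ × δ) ℂ where
  toFun M := Matrix.of fun x y =>
    ∑ r : ρ, ∑ r' : ρ, Ξ (mapSlice N r r' x.1 y.1) (blockAt M r r') x.2 y.2
  map_add' M M' := by
    ext x y
    have h : ∀ r r', blockAt (M + M') r r' = blockAt M r r' + blockAt M' r r' :=
      fun _ _ => rfl
    simp [h, Finset.sum_add_distrib]
  map_smul' c M := by
    ext x y
    have h : ∀ r r', blockAt (c • M) r r' = c • blockAt M r r' := fun _ _ => rfl
    simp [h, Finset.mul_sum]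

end Maps

/-- Linear maps from the operators on `A` to the operators on `B`. -/
abbrev QMap (A B : QSys) : Type := A.Op →ₗ[ℂ] B.Op

/-- Linear supermaps, taking maps from `A` to `B` to maps from `C` to `D`. -/
abbrev QSuperMap (A B C D : QSys) : Type := QMap A B →ₗ[ℂ] QMap C D

/-- A superchannel is a linear supermap `Ξ` such that `id ⊗ Ξ` takes bipartite channels to
channels, for every finite-dimensional reference system. -/
def IsSuperchannel {A B C D : QSys} (Ξ : QSuperMap A B C D) : Prop :=
  ∀ (n : ℕ) (N : Matrix (Fin n × A.Idx) (Fin n × A.Idx) ℂ →ₗ[ℂ]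
      Matrix (Fin n × B.Idx) (Fin n × B.Idx) ℂ),
    IsChannel N → IsChannel (idTensorSuper Ξ N)

/-- Completely positive-Wigner-preserving maps: Hermiticity-preserving linear maps `Φ` such that,
for every reference system `R`, the map `id ⊗ Φ` takes states with non-negative discrete Wigner
function to states with non-negative discrete Wigner function. -/
def IsCPWP {A B : QSys} (Φ : QMap A B) : Prop :=
  IsHermiticityPreserving Φ ∧
    ∀ (R : QSys) (ρ : (R.tensor A).Op), IsWignerPositiveState (R.tensor A) ρ →
      IsWignerPositiveState (R.tensor B) (idTensor R.Idx Φ ρ)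

/-- The supermap `id ⊗ Ξ` for a reference system `R`. -/
def refSuper (R : QSys) {A B C D : QSys} (Ξ : QSuperMap A B C D)
    (N : QMap (R.tensor A) (R.tensor B)) : QMap (R.tensor C) (R.tensor D) :=
  idTensorSuper (ρ := R.Idx) Ξ N

/-- CPWP superchannels: superchannels `Ξ` such that, for every reference system `R`, the supermap
`id ⊗ Ξ` takes CPWP channels to CPWP channels. (That the output is a channel is part of `Ξ` being
a superchannel.) -/
def IsCPWPSuperchannel {A B C D : QSys} (Ξ : QSuperMap A B C D) : Prop :=
  IsSuperchannel Ξ ∧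
    ∀ (R : QSys) (N : QMap (R.tensor A) (R.tensor B)),
      IsChannel N → IsCPWP N → IsCPWP (refSuper R Ξ N)

/-! ### Mana -/

/-- The discrete Wigner function of a map, `W(v|u) = (1 / d_B) Tr[A v * N (A u)]`. -/
def wignerMap {A B : QSys} (N : QMap A B) (v : B.Phase) (u : A.Phase) : ℂ :=
  (1 / (B.dim : ℂ)) * (phaseOp B v * N (phaseOp A u)).trace

/-- The mana `log max_u ∑ v, |W(v|u)|` of a map (natural logarithm). It is an extended real, since
the zero map has mana `log 0 = -∞`. -/
def mana {A B : QSys} (N : QMap A B) : EReal :=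
  ENNReal.log (ENNReal.ofReal (⨆ u : A.Phase, ∑ v : B.Phase, ‖wignerMap N v u‖))

end

/-!
The phase-space point operators are a basis in which an operator has its Wigner function as
coordinates, so that `W_{Ξ N}(t|w) = ∑ u v, W_N(v|u) * K(t, w; v, u)`, where `K(·; v, u)` is the
Wigner function of the image under `Ξ` of the transition map `X ↦ W_X(u) A_v`.

* `K` is non-negative. A channel is completely positive Wigner preserving exactly when its Wigner
  function is non-negative. With the reference system `A ⊗ B` this holds for the channel that
  exchanges the reference with the input and output of a map from `A` to `B`, and the entries of
  `K` are, up to positive factors, among the Wigner function of its image.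
* For every `f`, `∑ u t, K(t, w; f u, u) = 1`. Every trace-preserving map is an affine combination
  of channels, so a superchannel preserves trace preservation even of maps which are not positive;
  apply this to `X ↦ ∑ u, W_X(u) A_{f u}`.

Choosing `f u` to maximize `∑ t, K(t, w; v, u)` over `v` bounds `∑ t, |W_{Ξ N}(t|w)|` by the maximum
over `u` of `∑ v, |W_N(v|u)|`.
-/

noncomputable section

open QSys

/-! ### Phase-space point operators -/

/-- An operator basis with the features of the phase-space point operators that the argument uses:
unit trace, pairwise non-negative overlaps, stability under transposition, and the completeness
relation, written in matrix entries. -/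
structure IsPhaseSpaceBasis {ι κ : Type} [Fintype ι] [DecidableEq ι] [Fintype κ]
    (F : κ → Matrix ι ι ℂ) : Prop where
  trace_eq_one : ∀ u, (F u).trace = 1
  trace_mul_nonneg : ∀ u v, 0 ≤ (F u * F v).trace
  exists_eq_transpose : ∀ u, ∃ v, F v = (F u).transpose
  sum_mul_apply : ∀ i j k l,
    ∑ u, F u i j * F u k l = if i = l ∧ j = k then (Fintype.card ι : ℂ) else 0

namespace IsPhaseSpaceBasis

lemma one : IsPhaseSpaceBasis fun _ : Unit => (1 : Matrix Unit Unit ℂ) where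
  trace_eq_one _ := by simp
  trace_mul_nonneg _ _ := by simp
  exists_eq_transpose _ := ⟨(), by simp⟩
  sum_mul_apply _ _ _ _ := by simp

variable {ι κ ι' κ' : Type} [Fintype ι] [DecidableEq ι] [Fintype κ] [Fintype ι'] [DecidableEq ι']
  [Fintype κ'] {F : κ → Matrix ι ι ℂ} {G : κ' → Matrix ι' ι' ℂ}

lemma kronecker (hF : IsPhaseSpaceBasis F) (hG : IsPhaseSpaceBasis G) :
    IsPhaseSpaceBasis fun u : κ × κ' => F u.1 ⊗ₖ G u.2 where
  trace_eq_one u := by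
    rw [Matrix.trace_kronecker, hF.trace_eq_one, hG.trace_eq_one, one_mul]
  trace_mul_nonneg u v := by
    rw [← Matrix.mul_kronecker_mul, Matrix.trace_kronecker]
    exact mul_nonneg (hF.trace_mul_nonneg _ _) (hG.trace_mul_nonneg _ _)
  exists_eq_transpose u := by
    obtain ⟨v, hv⟩ := hF.exists_eq_transpose u.1
    obtain ⟨w, hw⟩ := hG.exists_eq_transpose u.2
    exact ⟨(v, w), by simp only [hv, hw, Matrix.kroneckerMap_transpose]⟩
  sum_mul_apply i j k l := by
    simp only [Fintype.sum_prod_type, Matrix.kroneckerMap_apply, mul_mul_mul_comm, ← Finset.mul_sum,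
      ← Finset.sum_mul, hF.sum_mul_apply, hG.sum_mul_apply, Fintype.card_prod, Nat.cast_mul,
      Prod.ext_iff, ite_zero_mul_ite_zero, and_and_and_comm]

lemma sum_trace_mul_smul (hF : IsPhaseSpaceBasis F) (X : Matrix ι ι ℂ) :
    ∑ u, (F u * X).trace • F u = (Fintype.card ι : ℂ) • X := by
  ext i j
  calc (∑ u, (F u * X).trace • F u) i j
      = ∑ u, ∑ k, ∑ l, X l k * (F u k l * F u i j) := by
        simp only [Matrix.sum_apply, Matrix.smul_apply, smul_eq_mul, Matrix.trace,
          Matrix.diag_apply, Matrix.mul_apply, Finset.sum_mul]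
        exact Finset.sum_congr rfl fun _ _ => Finset.sum_congr rfl fun _ _ =>
          Finset.sum_congr rfl fun _ _ => by ring
    _ = ∑ k, ∑ l, X l k * ∑ u, F u k l * F u i j := by
        rw [Finset.sum_comm]
        simp only [Finset.sum_comm (s := (Finset.univ : Finset κ)), Finset.mul_sum]
    _ = ((Fintype.card ι : ℂ) • X) i j := by
        simp [hF.sum_mul_apply, ite_and, mul_comm]

end IsPhaseSpaceBasis

section Qudit

variable {p : ℕ}

lemma two_mul_inv_two_of_odd (hp : Odd p) : (2 : ZMod p) * 2⁻¹ = 1 := by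
  simpa using ZMod.coe_mul_inv_eq_one 2 (Nat.coprime_two_left.mpr hp)

lemma natCast_half_of_odd (hp : Odd p) : (((p + 1) / 2 : ℕ) : ZMod p) = 2⁻¹ := by
  have h : (((p + 1) / 2 : ℕ) : ZMod p) * 2 = 1 := by
    exact_mod_cast show (((p + 1) / 2 * 2 : ℕ) : ZMod p) = 1 by
      rw [Nat.div_mul_cancel hp.add_one.two_dvd]; simp
  linear_combination 2⁻¹ * h - (((p + 1) / 2 : ℕ) : ZMod p) * two_mul_inv_two_of_odd hp

lemma two_mul_eq_iff_of_odd (hp : Odd p) {x y : ZMod p} : 2 * x = y ↔ x = 2⁻¹ * y := by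
  have h := two_mul_inv_two_of_odd hp
  exact ⟨fun hxy => by linear_combination 2⁻¹ * hxy - x * h,
    fun hxy => by linear_combination 2 * hxy + y * h⟩

lemma two_mul_right_inj_of_odd (hp : Odd p) {x y : ZMod p} : 2 * x = 2 * y ↔ x = y := by
  rw [two_mul_eq_iff_of_odd hp, ← mul_assoc, mul_comm 2⁻¹, two_mul_inv_two_of_odd hp, one_mul]

variable [NeZero p]

lemma exp_eq_stdAddChar_inv_two (hp : Odd p) :
    Complex.exp ((p + 1) * Real.pi * Complex.I / p) = ZMod.stdAddChar (2⁻¹ : ZMod p) := by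
  obtain ⟨m, hm⟩ := hp.add_one.two_dvd
  have hm' : (p : ℂ) + 1 = 2 * m := by exact_mod_cast hm
  have hhalf : ((m : ℤ) : ZMod p) = 2⁻¹ := by
    rw [← natCast_half_of_odd hp, hm, Nat.mul_div_cancel_left _ two_pos, Int.cast_natCast]
  rw [← hhalf, ZMod.stdAddChar_coe, hm', Int.cast_natCast]
  congr 1
  ring

lemma star_stdAddChar (x : ZMod p) :
    star (ZMod.stdAddChar x : ℂ) = ZMod.stdAddChar (-x) :=
  (AddChar.map_neg_eq_conj _ x).symm

lemma sum_stdAddChar_mul (b : ZMod p) :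
    ∑ x : ZMod p, (ZMod.stdAddChar (x * b) : ℂ) = if b = 0 then (p : ℂ) else 0 := by
  rw [AddChar.sum_mulShift b (ZMod.isPrimitive_stdAddChar p), ZMod.card, Nat.cast_ite,
    Nat.cast_zero]

lemma boostOp_pow (n : ℕ) :
    boostOp p ^ n = Matrix.diagonal fun j : ZMod p => ZMod.stdAddChar ((n : ZMod p) * j) := by
  rw [boostOp, Matrix.diagonal_pow]
  congr 1
  ext j
  rw [Pi.pow_apply, ← nsmul_eq_mul, AddChar.map_nsmul_eq_pow, ← Complex.exp_nat_mul,
    ZMod.stdAddChar_apply, ZMod.toCircle_apply]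
  congr 2
  ring

lemma shiftOp_pow (n : ℕ) :
    shiftOp p ^ n = Matrix.of fun k j : ZMod p => if k = j + n then (1 : ℂ) else 0 := by
  induction n with
  | zero => ext k j; simp [Matrix.one_apply]
  | succ n ih =>
    rw [pow_succ, ih]
    ext k j
    simp [Matrix.mul_apply, shiftOp, add_assoc, add_comm (1 : ZMod p)]

/-- The Heisenberg--Weyl operators of a qudit, by their matrix entries. -/
def quditWeyl (p : ℕ) [NeZero p] (a : ZMod p × ZMod p) : Matrix (ZMod p) (ZMod p) ℂ :=
  Matrix.of fun k j => if k = j + a.2 then ZMod.stdAddChar (a.1 * (k - 2⁻¹ * a.2)) else 0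

/-- The parity operator `|j⟩ ↦ |-j⟩` of a qudit. -/
def quditParity (p : ℕ) : Matrix (ZMod p) (ZMod p) ℂ :=
  Matrix.of fun k j => if k + j = 0 then 1 else 0

/-- The phase-space point operators of a qudit, by their matrix entries. -/
def quditPoint (p : ℕ) [NeZero p] (a : ZMod p × ZMod p) : Matrix (ZMod p) (ZMod p) ℂ :=
  Matrix.of fun k j => if k + j = 2 * a.2 then ZMod.stdAddChar (a.1 * (k - j)) else 0

lemma heisenbergWeyl_qudit (hp : p.Prime) (hodd : Odd p) :
    heisenbergWeyl (qudit p hp hodd) = quditWeyl p := by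
  funext a
  change Complex.exp ((p + 1) * Real.pi * Complex.I / p) ^ (-((a.1.val : ℤ) * (a.2.val : ℤ))) •
    (boostOp p ^ a.1.val * shiftOp p ^ a.2.val) = quditWeyl p a
  rw [exp_eq_stdAddChar_inv_two hodd, boostOp_pow, shiftOp_pow, ← AddChar.map_zsmul_eq_zpow]
  ext k j
  rw [Matrix.smul_apply, Matrix.diagonal_mul]
  simp only [quditWeyl, Matrix.of_apply, ZMod.natCast_zmod_val, smul_eq_mul, mul_ite, mul_one,
    mul_zero, ← AddChar.map_add_eq_mul]
  congr 2
  rw [zsmul_eq_mul]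
  push_cast
  simp only [ZMod.natCast_zmod_val]
  ring

lemma sum_quditWeyl (hp : Odd p) : ∑ a, quditWeyl p a = (p : ℂ) • quditParity p := by
  ext k j
  have hshift (b : ZMod p) : k = j + b ↔ b = k - j := by rw [← sub_eq_iff_eq_add', eq_comm]
  have hhalf : k - 2⁻¹ * (k - j) = 0 ↔ k + j = 0 := by
    rw [sub_eq_zero, ← two_mul_eq_iff_of_odd hp, ← sub_eq_zero]
    ring_nf
  simp only [quditWeyl, quditParity, Matrix.smul_apply, Matrix.sum_apply, Matrix.of_apply,
    Fintype.sum_prod_type, hshift, Finset.sum_ite_eq', Finset.mem_univ, if_true,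
    sum_stdAddChar_mul, hhalf, smul_eq_mul, mul_ite, mul_one, mul_zero]

lemma quditWeyl_mul_quditParity_mul_conjTranspose (a : ZMod p × ZMod p) :
    quditWeyl p a * quditParity p * (quditWeyl p a).conjTranspose = quditPoint p a := by
  ext k j
  have hshift (k b : ZMod p) : k = b + a.2 ↔ b = k - a.2 := by rw [← sub_eq_iff_eq_add, eq_comm]
  have hparity : k - a.2 + (j - a.2) = 0 ↔ k + j = 2 * a.2 := by
    rw [← sub_eq_zero (a := k + j)]
    ring_nf
  simp only [Matrix.mul_apply, Matrix.of_apply, Matrix.conjTranspose_apply, quditWeyl, quditParity,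
    quditPoint, hshift, apply_ite star, star_zero, star_stdAddChar, ite_mul, zero_mul,
    Finset.sum_ite_eq', Finset.mem_univ, if_true]
  simp only [mul_ite, mul_zero, mul_one, ite_mul, zero_mul, Finset.sum_ite_eq', Finset.mem_univ,
    if_true, hparity, ← AddChar.map_add_eq_mul]
  congr 2
  ring

lemma phaseOp_qudit (hp : p.Prime) (hodd : Odd p) :
    phaseOp (qudit p hp hodd) = quditPoint p := by
  have hzero : phaseOpZero (qudit p hp hodd) = quditParity p := by
    rw [phaseOpZero, heisenbergWeyl_qudit]
    change (1 / (Fintype.card (ZMod p) : ℂ)) • ∑ a, quditWeyl p a = quditParity p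
    rw [sum_quditWeyl hodd, ZMod.card, smul_smul, one_div_mul_cancel (NeZero.ne _), one_smul]
  funext a
  rw [phaseOp, hzero, heisenbergWeyl_qudit]
  exact quditWeyl_mul_quditParity_mul_conjTranspose a

lemma trace_quditPoint_mul_quditPoint (hp : Odd p) (a b : ZMod p × ZMod p) :
    (quditPoint p a * quditPoint p b).trace = if a = b then (p : ℂ) else 0 := by
  have hrow (k x : ZMod p) : k + x = 2 * a.2 ↔ x = 2 * a.2 - k := eq_sub_iff_add_eq'.symm
  have hchar (k : ZMod p) : (ZMod.stdAddChar (a.1 * (k - (2 * a.2 - k)) +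
      b.1 * (2 * a.2 - k - k)) : ℂ) =
      ZMod.stdAddChar (-(a.1 - b.1) * (2 * a.2)) * ZMod.stdAddChar (k * (2 * (a.1 - b.1))) := by
    rw [← AddChar.map_add_eq_mul]
    congr 1
    ring
  have htwo : 2 * (a.1 - b.1) = 0 ↔ a.1 = b.1 := by
    rw [mul_sub, sub_eq_zero, two_mul_right_inj_of_odd hp]
  simp only [Matrix.trace, Matrix.diag_apply, Matrix.mul_apply, quditPoint, Matrix.of_apply, hrow,
    ite_mul, zero_mul, Finset.sum_ite_eq', Finset.mem_univ, if_true]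
  simp only [mul_ite, mul_zero, sub_add_cancel, two_mul_right_inj_of_odd hp,
    ← AddChar.map_add_eq_mul]
  simp only [hchar, Finset.sum_ite_irrel, ← Finset.mul_sum, sum_stdAddChar_mul, htwo,
    Finset.sum_const_zero, Prod.ext_iff]
  split_ifs <;> simp_all

lemma sum_quditPoint_mul_apply (hp : Odd p) (i j k l : ZMod p) :
    ∑ a, quditPoint p a i j * quditPoint p a k l =
      if i = l ∧ j = k then (Fintype.card (ZMod p) : ℂ) else 0 := by
  have hpos (x : ZMod p) : i + j = 2 * x ↔ x = 2⁻¹ * (i + j) := by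
    rw [eq_comm, two_mul_eq_iff_of_odd hp]
  have hhalf : 2 * (2⁻¹ * (i + j)) = i + j := by
    rw [← mul_assoc, two_mul_inv_two_of_odd hp, one_mul]
  have hdelta : k + l = i + j ∧ i - j + (k - l) = 0 ↔ i = l ∧ j = k := by
    refine ⟨fun ⟨hsum, hdiff⟩ => ?_, fun ⟨hil, hjk⟩ => by rw [hil, hjk]; ring_nf; simp⟩
    have hil : i = l := (two_mul_right_inj_of_odd hp).mp (by linear_combination hdiff - hsum)
    exact ⟨hil, by linear_combination -hsum - hil⟩
  simp only [quditPoint, Matrix.of_apply, Fintype.sum_prod_type, hpos, ite_mul, zero_mul,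
    Finset.sum_ite_eq', Finset.mem_univ, if_true, hhalf]
  simp only [mul_ite, mul_zero,
    ← AddChar.map_add_eq_mul, ← mul_add, Finset.sum_ite_irrel, sum_stdAddChar_mul,
    Finset.sum_const_zero, ← ite_and, hdelta, ZMod.card]

lemma isPhaseSpaceBasis_quditPoint (hp : Odd p) : IsPhaseSpaceBasis (quditPoint p) where
  trace_eq_one a := by
    simp [Matrix.trace, quditPoint, ← two_mul, two_mul_right_inj_of_odd hp]
  trace_mul_nonneg a b := by
    rw [trace_quditPoint_mul_quditPoint hp]
    split_ifs
    exacts [Nat.cast_nonneg p, le_rfl]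
  exists_eq_transpose a := by
    refine ⟨(-a.1, a.2), ?_⟩
    ext k j
    simp only [Matrix.transpose_apply, quditPoint, Matrix.of_apply, add_comm j k]
    congr 2
    ring
  sum_mul_apply := sum_quditPoint_mul_apply hp

end Qudit

lemma phaseOp_unit : phaseOp unit = fun _ : Unit => (1 : Matrix Unit Unit ℂ) := by
  have hweyl : heisenbergWeyl unit = fun _ : Unit => (1 : Matrix Unit Unit ℂ) := rfl
  have hzero : phaseOpZero unit = (1 : Matrix Unit Unit ℂ) := by
    rw [phaseOpZero, hweyl]
    change (1 / (Fintype.card Unit : ℂ)) • ∑ _u : Unit, (1 : Matrix Unit Unit ℂ) = 1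
    simp
  funext u
  rw [phaseOp, hweyl, hzero]
  have hone : (1 : Matrix Unit Unit ℂ) * 1 * (1 : Matrix Unit Unit ℂ).conjTranspose = 1 := by simp
  exact hone

lemma dim_tensor (A B : QSys) : (A.tensor B).dim = A.dim * B.dim :=
  Fintype.card_prod A.Idx B.Idx

lemma phaseOpZero_tensor (A B : QSys) :
    phaseOpZero (A.tensor B) = phaseOpZero A ⊗ₖ phaseOpZero B := by
  rw [phaseOpZero, dim_tensor]
  change (1 / ((A.dim * B.dim : ℕ) : ℂ)) • ∑ u : A.Phase × B.Phase,
    heisenbergWeyl A u.1 ⊗ₖ heisenbergWeyl B u.2 = phaseOpZero A ⊗ₖ phaseOpZero B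
  ext i j
  simp only [phaseOpZero, Matrix.smul_apply, Matrix.sum_apply, Matrix.kroneckerMap_apply,
    Fintype.sum_prod_type, ← Finset.mul_sum, ← Finset.sum_mul, smul_eq_mul, Nat.cast_mul]
  ring

lemma phaseOp_tensor (A B : QSys) :
    phaseOp (A.tensor B) = fun u : A.Phase × B.Phase => phaseOp A u.1 ⊗ₖ phaseOp B u.2 := by
  funext u
  simp only [phaseOp, phaseOpZero_tensor, Matrix.mul_kronecker_mul]
  rw [← Matrix.conjTranspose_kronecker]
  rfl

theorem isPhaseSpaceBasis_phaseOp (A : QSys) : IsPhaseSpaceBasis (phaseOp A) := by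
  induction A with
  | unit =>
    rw [phaseOp_unit]
    exact .one
  | qudit p hp hodd =>
    have : NeZero p := ⟨hp.ne_zero⟩
    rw [phaseOp_qudit]
    exact isPhaseSpaceBasis_quditPoint hodd
  | tensor A B hA hB =>
    rw [phaseOp_tensor]
    exact hA.kronecker hB

lemma trace_phaseOp (A : QSys) (u : A.Phase) : (phaseOp A u).trace = 1 :=
  (isPhaseSpaceBasis_phaseOp A).trace_eq_one u

lemma trace_phaseOp_mul_phaseOp_nonneg (A : QSys) (u v : A.Phase) :
    0 ≤ (phaseOp A u * phaseOp A v).trace :=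
  (isPhaseSpaceBasis_phaseOp A).trace_mul_nonneg u v

lemma exists_phaseOp_eq_transpose (A : QSys) (u : A.Phase) :
    ∃ v, phaseOp A v = (phaseOp A u).transpose :=
  (isPhaseSpaceBasis_phaseOp A).exists_eq_transpose u

instance instNonemptyIdx (A : QSys) : Nonempty A.Idx := by
  induction A with
  | unit => exact inferInstanceAs (Nonempty Unit)
  | qudit p _ _ => exact inferInstanceAs (Nonempty (ZMod p))
  | tensor A B _ _ => exact inferInstanceAs (Nonempty (A.Idx × B.Idx))

lemma dim_pos (A : QSys) : 0 < A.dim := Fintype.card_pos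

lemma dim_cast_ne_zero (A : QSys) : (A.dim : ℂ) ≠ 0 := Nat.cast_ne_zero.mpr (dim_pos A).ne'

lemma one_div_dim_pos (A : QSys) : (0 : ℂ) < 1 / (A.dim : ℂ) :=
  one_div_pos.mpr (Nat.cast_pos.mpr (dim_pos A))

/-! ### Wigner functions -/

lemma sum_wigner_smul (A : QSys) (X : A.Op) : ∑ u, wigner A X u • phaseOp A u = X := by
  simp only [wigner, mul_smul, ← Finset.smul_sum, (isPhaseSpaceBasis_phaseOp A).sum_trace_mul_smul]
  rw [smul_smul]
  exact (congrArg (· • X) (one_div_mul_cancel (dim_cast_ne_zero A))).trans (one_smul ℂ X)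

lemma sum_wigner (A : QSys) (X : A.Op) : ∑ u, wigner A X u = X.trace := by
  conv_rhs => rw [← sum_wigner_smul A X, Matrix.trace_sum]
  simp only [Matrix.trace_smul, trace_phaseOp, smul_eq_mul, mul_one]

lemma wigner_map {A B : QSys} (Φ : QMap A B) (X : A.Op) (v : B.Phase) :
    wigner B (Φ X) v = ∑ u, wignerMap Φ v u * wigner A X u := by
  conv_lhs => rw [← sum_wigner_smul A X]
  simp only [wigner, wignerMap, map_sum, map_smul, Matrix.trace_sum,
    Matrix.mul_smul, Matrix.trace_smul, Finset.mul_sum, smul_eq_mul]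
  exact Finset.sum_congr rfl fun _ _ => by ring

/-! ### Weighted partial traces -/

section PartialTrace

variable {α β γ δ ρ : Type} [Fintype ρ]

/-- The partial trace `M ↦ Tr_ρ[(P ⊗ 1) M]` over the first factor, weighted by `P`. -/
def weightedPartialTrace (P : Matrix ρ ρ ℂ) :
    Matrix (ρ × α) (ρ × α) ℂ →ₗ[ℂ] Matrix α α ℂ where
  toFun M := ∑ r, ∑ s, P r s • blockAt M s r
  map_add' M M' := by
    simp only [← Finset.sum_add_distrib, ← smul_add]
    rfl
  map_smul' c M := by
    simp only [RingHom.id_apply, Finset.smul_sum, smul_comm c]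
    rfl

lemma weightedPartialTrace_apply (P : Matrix ρ ρ ℂ) (M : Matrix (ρ × α) (ρ × α) ℂ) :
    weightedPartialTrace P M = ∑ r, ∑ s, P r s • blockAt M s r := rfl

lemma trace_mul_weightedPartialTrace [Fintype α] (P : Matrix ρ ρ ℂ) (S : Matrix α α ℂ)
    (M : Matrix (ρ × α) (ρ × α) ℂ) :
    (S * weightedPartialTrace P M).trace = ((P ⊗ₖ S) * M).trace := by
  simp only [weightedPartialTrace_apply, Matrix.trace, Matrix.diag_apply, Matrix.mul_apply,
    Matrix.sum_apply, Matrix.smul_apply, blockAt, Matrix.of_apply, smul_eq_mul,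
    Matrix.kroneckerMap_apply, Fintype.sum_prod_type, Finset.mul_sum]
  simp only [Finset.sum_comm (s := (Finset.univ : Finset α)) (t := (Finset.univ : Finset ρ)),
    mul_left_comm, mul_assoc]

lemma weightedPartialTrace_kronecker (P F : Matrix ρ ρ ℂ) (X : Matrix α α ℂ) :
    weightedPartialTrace P (F ⊗ₖ X) = (P * F).trace • X := by
  ext a b
  simp only [weightedPartialTrace_apply, Matrix.sum_apply, Matrix.smul_apply, blockAt,
    Matrix.of_apply, Matrix.kroneckerMap_apply, Matrix.trace, Matrix.diag_apply, Matrix.mul_apply,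
    smul_eq_mul, Finset.sum_mul, mul_assoc]

lemma weightedPartialTrace_idTensor (P : Matrix ρ ρ ℂ) (Φ : Matrix α α ℂ →ₗ[ℂ] Matrix β β ℂ)
    (M : Matrix (ρ × α) (ρ × α) ℂ) :
    weightedPartialTrace P (idTensor ρ Φ M) = Φ (weightedPartialTrace P M) := by
  simp only [weightedPartialTrace_apply, map_sum, map_smul]
  rfl

/-- The map `X ↦ Tr_ρ[(P ⊗ 1) N(F ⊗ X)]`, obtained from a bipartite map by feeding `F` into the
reference system and testing its output against `P`. -/
def contractRef (P F : Matrix ρ ρ ℂ) (N : Matrix (ρ × α) (ρ × α) ℂ →ₗ[ℂ] Matrix (ρ × β) (ρ × β) ℂ) :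
    Matrix α α ℂ →ₗ[ℂ] Matrix β β ℂ :=
  weightedPartialTrace P ∘ₗ N ∘ₗ Matrix.kroneckerBilinear (R := ℂ) F

lemma contractRef_apply (P F : Matrix ρ ρ ℂ)
    (N : Matrix (ρ × α) (ρ × α) ℂ →ₗ[ℂ] Matrix (ρ × β) (ρ × β) ℂ) (X : Matrix α α ℂ) :
    contractRef P F N X = weightedPartialTrace P (N (F ⊗ₖ X)) := rfl

variable [DecidableEq ρ]

lemma blockAt_map_kronecker (N : Matrix (ρ × α) (ρ × α) ℂ →ₗ[ℂ] Matrix (ρ × β) (ρ × β) ℂ)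
    (F : Matrix ρ ρ ℂ) (X : Matrix α α ℂ) (r s : ρ) :
    blockAt (N (F ⊗ₖ X)) r s = ∑ k, ∑ l, F k l • mapSlice N k l r s X := by
  have hF : F ⊗ₖ X = ∑ k, ∑ l, F k l • (Matrix.single k l (1 : ℂ) ⊗ₖ X) := by
    conv_lhs => rw [Matrix.matrix_eq_sum_single F]
    ext x y
    simp [Matrix.sum_apply, Matrix.single_apply, Finset.sum_mul]
  ext i j
  simp only [hF, map_sum, map_smul, blockAt, mapSlice, Matrix.of_apply, Matrix.sum_apply,
    Matrix.smul_apply, LinearMap.coe_mk, AddHom.coe_mk]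

lemma contractRef_eq_sum_mapSlice (P F : Matrix ρ ρ ℂ)
    (N : Matrix (ρ × α) (ρ × α) ℂ →ₗ[ℂ] Matrix (ρ × β) (ρ × β) ℂ) :
    contractRef P F N = ∑ r, ∑ s, P r s • ∑ k, ∑ l, F k l • mapSlice N k l s r := by
  ext1 X
  simp only [contractRef_apply, weightedPartialTrace_apply, blockAt_map_kronecker,
    LinearMap.sum_apply, LinearMap.smul_apply]

lemma blockAt_idTensorSuper
    (Ξ : (Matrix α α ℂ →ₗ[ℂ] Matrix β β ℂ) →ₗ[ℂ] (Matrix γ γ ℂ →ₗ[ℂ] Matrix δ δ ℂ))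
    (N : Matrix (ρ × α) (ρ × α) ℂ →ₗ[ℂ] Matrix (ρ × β) (ρ × β) ℂ)
    (M : Matrix (ρ × γ) (ρ × γ) ℂ) (r s : ρ) :
    blockAt (idTensorSuper Ξ N M) r s = ∑ k, ∑ l, Ξ (mapSlice N k l r s) (blockAt M k l) := by
  ext i j
  simp only [blockAt, idTensorSuper, LinearMap.coe_mk, AddHom.coe_mk, Matrix.of_apply,
    Matrix.sum_apply]

lemma contractRef_idTensorSuper
    (Ξ : (Matrix α α ℂ →ₗ[ℂ] Matrix β β ℂ) →ₗ[ℂ] (Matrix γ γ ℂ →ₗ[ℂ] Matrix δ δ ℂ))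
    (P F : Matrix ρ ρ ℂ)
    (N : Matrix (ρ × α) (ρ × α) ℂ →ₗ[ℂ] Matrix (ρ × β) (ρ × β) ℂ) :
    contractRef P F (idTensorSuper Ξ N) = Ξ (contractRef P F N) := by
  have hblock (X : Matrix γ γ ℂ) (k l : ρ) : blockAt (F ⊗ₖ X) k l = F k l • X := rfl
  ext1 X
  simp only [contractRef_eq_sum_mapSlice P F N, contractRef_apply, weightedPartialTrace_apply,
    blockAt_idTensorSuper, hblock, map_sum, map_smul, LinearMap.sum_apply, LinearMap.smul_apply]

end PartialTrace

lemma wigner_tensor (R A : QSys) (M : (R.tensor A).Op) (r : R.Phase) (a : A.Phase) :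
    wigner (R.tensor A) M (r, a) =
      1 / (R.dim : ℂ) * wigner A (weightedPartialTrace (phaseOp R r) M) a := by
  have htrace : (phaseOp (R.tensor A) (r, a) * M).trace =
      (phaseOp A a * weightedPartialTrace (phaseOp R r) M).trace := by
    rw [phaseOp_tensor]
    exact (trace_mul_weightedPartialTrace _ _ _).symm
  unfold wigner
  rw [htrace, dim_tensor, Nat.cast_mul, ← mul_assoc, one_div_mul_one_div]

lemma wigner_idTensor (R : QSys) {A B : QSys} (Φ : QMap A B) (M : (R.tensor A).Op) (r : R.Phase)
    (v : B.Phase) :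
    wigner (R.tensor B) (idTensor R.Idx Φ M) (r, v) =
      ∑ u, wignerMap Φ v u * wigner (R.tensor A) M (r, u) := by
  have htrace := weightedPartialTrace_idTensor (phaseOp R r) Φ M
  calc wigner (R.tensor B) (idTensor R.Idx Φ M) (r, v)
      = 1 / (R.dim : ℂ) * wigner B (Φ (weightedPartialTrace (phaseOp R r) M)) v :=
        (wigner_tensor R B _ r v).trans (by rw [htrace])
    _ = ∑ u, wignerMap Φ v u *
          (1 / (R.dim : ℂ) * wigner A (weightedPartialTrace (phaseOp R r) M) u) := by
        rw [wigner_map, Finset.mul_sum]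
        exact Finset.sum_congr rfl fun _ _ => mul_left_comm _ _ _
    _ = ∑ u, wignerMap Φ v u * wigner (R.tensor A) M (r, u) := by
        simp only [wigner_tensor]

lemma wignerMap_tensor (R : QSys) {A B : QSys} (N : QMap (R.tensor A) (R.tensor B))
    (r s : R.Phase) (v : B.Phase) (u : A.Phase) :
    wignerMap N (s, v) (r, u) =
      1 / (R.dim : ℂ) * wignerMap (contractRef (phaseOp R s) (phaseOp R r) N) v u := by
  refine (wigner_tensor R B (N (phaseOp (R.tensor A) (r, u))) s v).trans ?_
  rw [phaseOp_tensor]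
  rfl

lemma wignerMap_refSuper (R : QSys) {A B C D : QSys} (Ξ : QSuperMap A B C D)
    (N : QMap (R.tensor A) (R.tensor B)) (r s : R.Phase) (t : D.Phase) (w : C.Phase) :
    wignerMap (refSuper R Ξ N) (s, t) (r, w) =
      1 / (R.dim : ℂ) * wignerMap (Ξ (contractRef (phaseOp R s) (phaseOp R r) N)) t w :=
  (wignerMap_tensor R _ r s t w).trans <| congrArg (fun Φ => 1 / (R.dim : ℂ) * wignerMap Φ t w)
    (contractRef_idTensorSuper Ξ (phaseOp R s) (phaseOp R r) N)

/-! ### Channels -/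

section Channels

variable {α β : Type}

lemma IsCompletelyPositive.posSemidef_idTensor {ρ : Type} [Finite ρ]
    {Φ : Matrix α α ℂ →ₗ[ℂ] Matrix β β ℂ} (hΦ : IsCompletelyPositive Φ)
    {M : Matrix (ρ × α) (ρ × α) ℂ} (hM : M.PosSemidef) : (idTensor ρ Φ M).PosSemidef := by
  obtain ⟨n, ⟨e⟩⟩ := Finite.exists_equiv_fin ρ
  have hrelabel : idTensor ρ Φ M = (idTensor (Fin n) Φ
      (M.submatrix (Prod.map e.symm id) (Prod.map e.symm id))).submatrix
        (Prod.map e id) (Prod.map e id) := by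
    ext x y
    simp [idTensor, blockAt]
  rw [hrelabel]
  exact (hΦ n _ (hM.submatrix _)).submatrix _

lemma IsCompletelyPositive.map_posSemidef {Φ : Matrix α α ℂ →ₗ[ℂ] Matrix β β ℂ}
    (hΦ : IsCompletelyPositive Φ) {M : Matrix α α ℂ} (hM : M.PosSemidef) : (Φ M).PosSemidef :=
  (hΦ.posSemidef_idTensor (ρ := Unit) (hM.submatrix Prod.snd)).submatrix fun b => ((), b)

open scoped MatrixOrder Matrix.Norms.L2Operator in
lemma IsCompletelyPositive.isHermiticityPreserving [Finite α]
    {Φ : Matrix α α ℂ →ₗ[ℂ] Matrix β β ℂ} (hΦ : IsCompletelyPositive Φ) :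
    IsHermiticityPreserving Φ := by
  classical
  have := Fintype.ofFinite α
  intro M hM
  rw [← CFC.posPart_sub_negPart M hM.isSelfAdjoint, map_sub]
  exact (hΦ.map_posSemidef (Matrix.nonneg_iff_posSemidef.mp (CFC.posPart_nonneg M))).isHermitian.sub
    (hΦ.map_posSemidef (Matrix.nonneg_iff_posSemidef.mp (CFC.negPart_nonneg M))).isHermitian

lemma IsCompletelyPositive.idTensor {ρ : Type} [Finite ρ] {Φ : Matrix α α ℂ →ₗ[ℂ] Matrix β β ℂ}
    (hΦ : IsCompletelyPositive Φ) : IsCompletelyPositive (idTensor ρ Φ) := fun n _ hM =>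
  (hΦ.posSemidef_idTensor (ρ := Fin n × ρ) (hM.submatrix (Equiv.prodAssoc _ _ _))).submatrix
    (Equiv.prodAssoc _ _ _).symm

variable [Fintype α]

/-- The measure-and-prepare map `X ↦ Tr[P X] σ`, as a bilinear function of the effect `P` and the
prepared state `σ`. -/
def measPrep : Matrix α α ℂ →ₗ[ℂ] Matrix β β ℂ →ₗ[ℂ] Matrix α α ℂ →ₗ[ℂ] Matrix β β ℂ :=
  LinearMap.smulRightₗ ∘ₗ
    (LinearMap.mul ℂ (Matrix α α ℂ)).compr₂ (Matrix.traceLinearMap α ℂ ℂ)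

lemma measPrep_apply (P : Matrix α α ℂ) (σ : Matrix β β ℂ) (X : Matrix α α ℂ) :
    measPrep P σ X = (P * X).trace • σ := rfl

open scoped MatrixOrder Matrix.Norms.L2Operator in
lemma posSemidef_trace_mul_blockAt {ρ : Type} [Finite ρ] {P : Matrix α α ℂ} (hP : P.PosSemidef)
    {M : Matrix (ρ × α) (ρ × α) ℂ} (hM : M.PosSemidef) :
    (Matrix.of fun r s => (P * blockAt M r s).trace).PosSemidef := by
  classical
  have := Fintype.ofFinite ρ
  obtain ⟨Q, rfl⟩ := CStarAlgebra.nonneg_iff_eq_star_mul_self.mp hP.nonneg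
  let K (c : α) : Matrix (ρ × α) ρ ℂ :=
    Matrix.of fun x r => if x.1 = r then star (Q c x.2) else 0
  have hkraus : (Matrix.of fun r s => (star Q * Q * blockAt M r s).trace) =
      ∑ c, (K c).conjTranspose * M * K c := by
    ext r s
    simp only [K, Matrix.of_apply, Matrix.trace, Matrix.diag_apply, Matrix.mul_apply,
      Matrix.sum_apply, Matrix.conjTranspose_apply, Matrix.star_eq_conjTranspose, blockAt,
      Fintype.sum_prod_type, apply_ite star, star_star, star_zero, ite_mul, mul_ite, zero_mul,
      mul_zero, Finset.sum_ite_irrel, Finset.sum_const_zero, Finset.sum_ite_eq', Finset.mem_univ,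
      if_true, Finset.sum_mul]
    rw [Finset.sum_congr rfl fun _ _ => Finset.sum_comm, Finset.sum_comm]
    exact Finset.sum_congr rfl fun _ _ => Finset.sum_congr rfl fun _ _ =>
      Finset.sum_congr rfl fun _ _ => by ring
  rw [hkraus]
  exact Matrix.posSemidef_sum _ fun c _ => hM.conjTranspose_mul_mul_same _

lemma isCompletelyPositive_measPrep [Finite β] {P : Matrix α α ℂ} (hP : P.PosSemidef)
    {σ : Matrix β β ℂ} (hσ : σ.PosSemidef) : IsCompletelyPositive (measPrep P σ) := fun _ _ hM =>
  (posSemidef_trace_mul_blockAt hP hM).kronecker hσ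

variable [Fintype β]

lemma IsTracePreserving.idTensor {ρ : Type} [Fintype ρ] {Φ : Matrix α α ℂ →ₗ[ℂ] Matrix β β ℂ}
    (hΦ : IsTracePreserving Φ) : IsTracePreserving (idTensor ρ Φ) := fun M => by
  simp only [Matrix.trace, Fintype.sum_prod_type]
  exact Finset.sum_congr rfl fun r _ => hΦ (blockAt M r r)

lemma IsChannel.idTensor {ρ : Type} [Fintype ρ] {Φ : Matrix α α ℂ →ₗ[ℂ] Matrix β β ℂ}
    (hΦ : IsChannel Φ) : IsChannel (idTensor ρ Φ) :=
  ⟨hΦ.1.idTensor, hΦ.2.idTensor⟩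

lemma isChannel_measPrep_add_measPrep [DecidableEq α] {P : Matrix α α ℂ} (hP : P.PosSemidef)
    (hP' : (1 - P).PosSemidef) {σ τ : Matrix β β ℂ} (hσ : σ.PosSemidef) (hσ' : σ.trace = 1)
    (hτ : τ.PosSemidef) (hτ' : τ.trace = 1) :
    IsChannel (measPrep P σ + measPrep (1 - P) τ) := by
  refine ⟨fun n M hM => ?_, fun X => ?_⟩
  · exact (isCompletelyPositive_measPrep hP hσ n M hM).add
      (isCompletelyPositive_measPrep hP' hτ n M hM)
  · rw [LinearMap.add_apply, measPrep_apply, measPrep_apply, Matrix.trace_add, Matrix.trace_smul,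
      Matrix.trace_smul, hσ', hτ', ← add_smul, ← Matrix.trace_add, ← add_mul, add_sub_cancel,
      one_mul, smul_eq_mul, mul_one]

end Channels

section AffineHull

variable {α β : Type}

open scoped MatrixOrder Matrix.Norms.L2Operator in
lemma span_posSemidef_le_one [Finite α] [DecidableEq α] :
    Submodule.span ℂ {P : Matrix α α ℂ | P.PosSemidef ∧ (1 - P).PosSemidef} = ⊤ := by
  have := Fintype.ofFinite α
  rw [← CStarAlgebra.span_nonneg_inter_unitClosedBall (A := Matrix α α ℂ)]
  congr 1
  ext P
  simp only [Set.mem_ofPred_eq, Set.mem_inter_iff, mem_closedBall_zero_iff,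
    ← Matrix.nonneg_iff_posSemidef, sub_nonneg]
  exact and_congr_right fun hP => (CStarAlgebra.norm_le_one_iff_of_nonneg P hP).symm

variable [Fintype α]

lemma eq_sum_measPrep [DecidableEq α] (Φ : Matrix α α ℂ →ₗ[ℂ] Matrix β β ℂ) :
    Φ = ∑ i, ∑ j, measPrep (Matrix.single j i 1) (Φ (Matrix.single i j 1)) := by
  ext1 X
  have hX : X = ∑ i, ∑ j, X i j • Matrix.single i j 1 := by
    simpa only [Matrix.smul_single, smul_eq_mul, mul_one] using Matrix.matrix_eq_sum_single X
  conv_lhs => rw [hX]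
  simp only [map_sum, map_smul, LinearMap.sum_apply, measPrep_apply, Matrix.trace_single_mul,
    one_smul]

variable [Fintype β]

open scoped MatrixOrder Matrix.Norms.L2Operator in
lemma span_posSemidef_trace_eq_one :
    Submodule.span ℂ {σ : Matrix α α ℂ | σ.PosSemidef ∧ σ.trace = 1} = ⊤ := by
  classical
  rw [eq_top_iff, ← CStarAlgebra.span_nonneg (A := Matrix α α ℂ), Submodule.span_le]
  intro P hP
  have hpos := Matrix.nonneg_iff_posSemidef.mp hP
  obtain htrace | htrace := eq_or_ne P.trace 0
  · rw [hpos.trace_eq_zero_iff.mp htrace]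
    exact zero_mem _
  · rw [← smul_inv_smul₀ htrace P]
    refine Submodule.smul_mem _ _ (Submodule.subset_span ⟨hpos.smul ?_, ?_⟩)
    · exact inv_nonneg.mpr hpos.trace_nonneg
    · rw [Matrix.trace_smul, smul_eq_mul, inv_mul_cancel₀ htrace]

lemma exists_posSemidef_trace_eq_one [Nonempty β] :
    ∃ τ : Matrix β β ℂ, τ.PosSemidef ∧ τ.trace = 1 := by
  classical
  refine ⟨(Fintype.card β : ℂ)⁻¹ • 1, Matrix.PosSemidef.one.smul (by positivity), ?_⟩
  rw [Matrix.trace_smul, Matrix.trace_one, smul_eq_mul, inv_mul_cancel₀ (by simp)]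

variable {V : Type*} [AddCommGroup V] [Module ℂ V]
  {L : (Matrix α α ℂ →ₗ[ℂ] Matrix β β ℂ) →ₗ[ℂ] V} {c : V}

lemma map_measPrep_eq_trace_smul (hL : ∀ Φ, IsChannel Φ → L Φ = c) {τ : Matrix β β ℂ}
    (hτ : τ.PosSemidef) (hτ' : τ.trace = 1) (P : Matrix α α ℂ) (σ : Matrix β β ℂ) :
    L (measPrep P σ) = L (measPrep P (σ.trace • τ)) := by
  classical
  suffices hext : measPrep.compr₂ L = (measPrep.compl₂
      ((Matrix.traceLinearMap β ℂ ℂ).smulRight τ)).compr₂ L from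
    LinearMap.congr_fun (LinearMap.congr_fun hext P) σ
  refine LinearMap.ext_on span_posSemidef_le_one fun P ⟨hP, hP'⟩ => ?_
  refine LinearMap.ext_on span_posSemidef_trace_eq_one fun σ ⟨hσ, hσ'⟩ => ?_
  have hprep : L (measPrep P σ + measPrep (1 - P) τ) = L (measPrep P τ + measPrep (1 - P) τ) :=
    (hL _ (isChannel_measPrep_add_measPrep hP hP' hσ hσ' hτ hτ')).trans
      (hL _ (isChannel_measPrep_add_measPrep hP hP' hτ hτ' hτ hτ')).symm
  rw [map_add, map_add, add_left_inj] at hprep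
  simpa [hσ'] using hprep

theorem IsTracePreserving.map_eq_of_forall_isChannel [Nonempty β]
    (hL : ∀ Φ, IsChannel Φ → L Φ = c) {Φ : Matrix α α ℂ →ₗ[ℂ] Matrix β β ℂ}
    (hΦ : IsTracePreserving Φ) : L Φ = c := by
  classical
  obtain ⟨τ, hτ, hτ'⟩ := exists_posSemidef_trace_eq_one (β := β)
  have hchannel : IsChannel (measPrep (1 : Matrix α α ℂ) τ) := by
    have h := isChannel_measPrep_add_measPrep (P := (1 : Matrix α α ℂ)) .one
      ((sub_self (1 : Matrix α α ℂ)).symm ▸ .zero) hτ hτ' hτ hτ'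
    rwa [sub_self, map_zero, LinearMap.zero_apply, add_zero] at h
  have hΨ (X : Matrix α α ℂ) : measPrep 1 τ X = X.trace • τ := by rw [measPrep_apply, one_mul]
  calc L Φ
      = ∑ i, ∑ j, L (measPrep (Matrix.single j i 1) ((Φ (Matrix.single i j 1)).trace • τ)) := by
        conv_lhs => rw [eq_sum_measPrep Φ]
        simp only [map_sum, map_measPrep_eq_trace_smul hL hτ hτ' _ (Φ _)]
    _ = L (measPrep 1 τ) := by
        conv_rhs => rw [eq_sum_measPrep (measPrep 1 τ)]
        simp only [map_sum, hΦ _, hΨ]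
    _ = c := hL _ hchannel

end AffineHull

lemma IsTracePreserving.contractRef_one_one {α β ρ : Type} [Fintype α] [Fintype β] [Unique ρ]
    [Fintype ρ] [DecidableEq ρ]
    {N : Matrix (ρ × α) (ρ × α) ℂ →ₗ[ℂ] Matrix (ρ × β) (ρ × β) ℂ} (hN : IsTracePreserving N) :
    IsTracePreserving (contractRef 1 1 N) := fun X => by
  have htrace (M : Matrix (ρ × β) (ρ × β) ℂ) : (weightedPartialTrace 1 M).trace = M.trace := by
    classical
    simpa using trace_mul_weightedPartialTrace 1 1 M
  rw [contractRef_apply, htrace, hN, Matrix.trace_kronecker]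
  simp

lemma contractRef_idTensor {α β ρ : Type} [Fintype ρ] (P F : Matrix ρ ρ ℂ)
    (Φ : Matrix α α ℂ →ₗ[ℂ] Matrix β β ℂ) :
    contractRef P F (idTensor ρ Φ) = (P * F).trace • Φ := by
  ext1 X
  rw [contractRef_apply, weightedPartialTrace_idTensor, weightedPartialTrace_kronecker, map_smul,
    LinearMap.smul_apply]

theorem IsSuperchannel.map_isTracePreserving {A B C D : QSys} {Ξ : QSuperMap A B C D}
    (hΞ : IsSuperchannel Ξ) {Φ : QMap A B} (hΦ : IsTracePreserving Φ) :
    IsTracePreserving (Ξ Φ) := fun M => by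
  let L : QMap A B →ₗ[ℂ] ℂ := Matrix.traceLinearMap D.Idx ℂ ℂ ∘ₗ Ξ.flip M
  refine hΦ.map_eq_of_forall_isChannel (L := L) (c := M.trace) fun Ψ hΨ => ?_
  have h := (hΞ 1 _ hΨ.idTensor).2.contractRef_one_one
  rw [contractRef_idTensorSuper, contractRef_idTensor] at h
  have htrace : ((Ξ Ψ) M).trace = M.trace := by simpa using h M
  exact htrace

/-! ### Wigner-preserving channels -/

lemma IsChannel.isCPWP_of_wignerMap_nonneg {A B : QSys} {Φ : QMap A B} (hΦ : IsChannel Φ)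
    (hW : ∀ v u, 0 ≤ wignerMap Φ v u) : IsCPWP Φ := by
  refine ⟨hΦ.1.isHermiticityPreserving, fun R M ⟨hpos, htrace, hM⟩ =>
    ⟨hΦ.1.posSemidef_idTensor hpos, (hΦ.2.idTensor M).trans htrace, fun x => ?_⟩⟩
  refine le_of_le_of_eq ?_ (wigner_idTensor R Φ M x.1 x.2).symm
  exact Finset.sum_nonneg fun u _ => mul_nonneg (hW _ _) (hM (x.1, u))

lemma nonneg_of_one_div_dim_mul_nonneg (A : QSys) {z : ℂ} (h : 0 ≤ 1 / (A.dim : ℂ) * z) :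
    0 ≤ z := by
  have h' := mul_nonneg (Nat.cast_nonneg (α := ℂ) A.dim) h
  rwa [← mul_assoc, mul_one_div_cancel (dim_cast_ne_zero A), one_mul] at h'

section MaxEntangled

variable (α : Type) [Fintype α] [DecidableEq α]

/-- The maximally entangled state of two copies of a system with basis labels `α`. -/
def maxEntangled : Matrix (α × α) (α × α) ℂ :=
  (1 / (Fintype.card α : ℂ)) • Matrix.vecMulVec (fun x : α × α => if x.1 = x.2 then 1 else 0)
    (fun x => if x.1 = x.2 then 1 else 0)

lemma weightedPartialTrace_maxEntangled (P : Matrix α α ℂ) :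
    weightedPartialTrace P (maxEntangled α) = (1 / (Fintype.card α : ℂ)) • P.transpose := by
  ext i j
  simp [weightedPartialTrace_apply, maxEntangled, blockAt, Matrix.sum_apply,
    Matrix.vecMulVec_apply, mul_comm]

lemma posSemidef_maxEntangled : (maxEntangled α).PosSemidef := by
  let f : α × α → ℂ := fun x => if x.1 = x.2 then 1 else 0
  have hf : star f = f := by
    ext x
    simp [f, apply_ite star]
  have hcard : (0 : ℂ) ≤ 1 / (Fintype.card α : ℂ) := by positivity
  have h := (Matrix.posSemidef_vecMulVec_self_star f).smul hcard
  rwa [hf] at h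

lemma trace_maxEntangled [Nonempty α] : (maxEntangled α).trace = 1 := by
  have h := trace_mul_weightedPartialTrace 1 1 (maxEntangled α)
  rw [weightedPartialTrace_maxEntangled, one_mul, Matrix.one_kronecker_one, one_mul] at h
  rw [← h, Matrix.transpose_one, Matrix.trace_smul, Matrix.trace_one]
  exact one_div_mul_cancel (Nat.cast_ne_zero.mpr Fintype.card_ne_zero)

end MaxEntangled

lemma isWignerPositiveState_maxEntangled (A : QSys) :
    IsWignerPositiveState (A.tensor A) (maxEntangled A.Idx) := by
  refine ⟨posSemidef_maxEntangled A.Idx, trace_maxEntangled A.Idx, ?_⟩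
  rintro ⟨u, v⟩
  obtain ⟨u', hu'⟩ := exists_phaseOp_eq_transpose A u
  have hcond : weightedPartialTrace (phaseOp A u) (maxEntangled A.Idx) =
      (1 / (A.dim : ℂ)) • phaseOp A u' :=
    hu' ▸ weightedPartialTrace_maxEntangled A.Idx (phaseOp A u)
  refine le_of_le_of_eq ?_ (wigner_tensor A A (maxEntangled A.Idx) u v).symm
  rw [hcond, wigner, Matrix.mul_smul, Matrix.trace_smul, smul_eq_mul]
  have hd := (one_div_dim_pos A).le
  exact mul_nonneg hd (mul_nonneg hd (mul_nonneg hd (trace_phaseOp_mul_phaseOp_nonneg A v u')))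

lemma IsCPWP.wignerMap_nonneg {A B : QSys} {Φ : QMap A B} (hΦ : IsCPWP Φ) (v : B.Phase)
    (u : A.Phase) : 0 ≤ wignerMap Φ v u := by
  obtain ⟨u', hu'⟩ := exists_phaseOp_eq_transpose A u
  have hcond : weightedPartialTrace (phaseOp A u') (maxEntangled A.Idx) =
      (1 / (A.dim : ℂ)) • phaseOp A u := by
    rw [← Matrix.transpose_transpose (phaseOp A u), ← hu']
    exact weightedPartialTrace_maxEntangled A.Idx (phaseOp A u')
  have h := nonneg_of_one_div_dim_mul_nonneg A
    (((hΦ.2 A _ (isWignerPositiveState_maxEntangled A)).2.2 (u', v)).trans_eq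
      (wigner_tensor A B (idTensor A.Idx Φ (maxEntangled A.Idx)) u' v))
  rw [weightedPartialTrace_idTensor, hcond, map_smul, wigner, Matrix.mul_smul, Matrix.trace_smul,
    smul_eq_mul, mul_left_comm] at h
  exact nonneg_of_one_div_dim_mul_nonneg A h

/-! ### The exchange channel -/

section Exchange

variable {α β : Type} [Fintype α] [Fintype β] [DecidableEq β]

/-- The channel from `(α ⊗ β) ⊗ α` to `(α ⊗ β) ⊗ β` that discards the first factor, moves the
other two to the places of the same type, and prepares the maximally mixed state in the remaining
place. -/
def exchangeMap (α β : Type) [Fintype α] [Fintype β] [DecidableEq β] :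
    Matrix ((α × β) × α) ((α × β) × α) ℂ →ₗ[ℂ] Matrix ((α × β) × β) ((α × β) × β) ℂ where
  toFun X := Matrix.of fun i j => (if i.1.2 = j.1.2 then 1 / (Fintype.card β : ℂ) else 0) *
    ∑ x, X ((x, i.2), i.1.1) ((x, j.2), j.1.1)
  map_add' X Y := by
    ext i j
    simp [Finset.sum_add_distrib, mul_add]
  map_smul' c X := by
    ext i j
    simp only [Matrix.smul_apply, Matrix.of_apply, smul_eq_mul, ← Finset.mul_sum,
      RingHom.id_apply]
    ring

lemma exchangeMap_kronecker (F G : Matrix α α ℂ) (H : Matrix β β ℂ) :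
    exchangeMap α β ((F ⊗ₖ H) ⊗ₖ G) =
      (F.trace / (Fintype.card β : ℂ)) • ((G ⊗ₖ (1 : Matrix β β ℂ)) ⊗ₖ H) := by
  ext i j
  simp only [exchangeMap, LinearMap.coe_mk, AddHom.coe_mk, Matrix.of_apply,
    Matrix.kroneckerMap_apply, Matrix.smul_apply, Matrix.one_apply, smul_eq_mul,
    ← Finset.sum_mul, Matrix.trace, Matrix.diag_apply]
  split_ifs <;> ring

lemma contractRef_exchangeMap (P F : Matrix α α ℂ) (Q H : Matrix β β ℂ) :
    contractRef (P ⊗ₖ Q) (F ⊗ₖ H) (exchangeMap α β) =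
      (F.trace * Q.trace / (Fintype.card β : ℂ)) • measPrep P H := by
  ext1 X
  rw [contractRef_apply, exchangeMap_kronecker, map_smul, weightedPartialTrace_kronecker,
    ← Matrix.mul_kronecker_mul, mul_one, Matrix.trace_kronecker, LinearMap.smul_apply,
    measPrep_apply, smul_smul, smul_smul]
  congr 1
  ring

lemma isCompletelyPositive_exchangeMap : IsCompletelyPositive (exchangeMap α β) := fun n M hM => by
  let discard (x : α) (i : Fin n × β × α) : Fin n × (α × β) × α := (i.1, (x, i.2.1), i.2.2)
  let rearrange (i : Fin n × (α × β) × β) : (Fin n × β × α) × β := ((i.1, i.2.2, i.2.1.1), i.2.1.2)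
  have hdiscard : (∑ x, M.submatrix (discard x) (discard x)).PosSemidef :=
    Matrix.posSemidef_sum _ fun x _ => hM.submatrix _
  have hcard : (0 : ℂ) ≤ 1 / (Fintype.card β : ℂ) := by positivity
  have hprepare : idTensor (Fin n) (exchangeMap α β) M =
      ((∑ x, M.submatrix (discard x) (discard x)) ⊗ₖ
        ((1 / (Fintype.card β : ℂ)) • (1 : Matrix β β ℂ))).submatrix rearrange rearrange := by
    ext i j
    simp only [idTensor, exchangeMap, blockAt, discard, rearrange, LinearMap.coe_mk, AddHom.coe_mk,
      Matrix.of_apply, Matrix.submatrix_apply, Matrix.kroneckerMap_apply, Matrix.sum_apply,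
      Matrix.smul_apply, Matrix.one_apply, smul_eq_mul]
    split_ifs <;> ring
  rw [hprepare]
  exact (hdiscard.kronecker (Matrix.PosSemidef.one.smul hcard)).submatrix _

lemma isTracePreserving_exchangeMap [Nonempty β] : IsTracePreserving (exchangeMap α β) :=
  fun X => by
  have hcard : (Fintype.card β : ℂ) ≠ 0 := Nat.cast_ne_zero.mpr Fintype.card_ne_zero
  simp only [Matrix.trace, Matrix.diag_apply, Fintype.sum_prod_type, exchangeMap,
    LinearMap.coe_mk, AddHom.coe_mk, Matrix.of_apply, if_true, ← Finset.mul_sum,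
    Finset.sum_const, Finset.card_univ, nsmul_eq_mul]
  rw [← mul_assoc, one_div, inv_mul_cancel₀ hcard, one_mul]
  exact Finset.sum_comm.trans ((Finset.sum_congr rfl fun _ _ => Finset.sum_comm).trans
    Finset.sum_comm)

lemma isChannel_exchangeMap [Nonempty β] : IsChannel (exchangeMap α β) :=
  ⟨isCompletelyPositive_exchangeMap, isTracePreserving_exchangeMap⟩

end Exchange

lemma contractRef_phaseOp_exchangeMap (A B : QSys) (s r : (A.tensor B).Phase) :
    contractRef (phaseOp (A.tensor B) s) (phaseOp (A.tensor B) r) (exchangeMap A.Idx B.Idx) =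
      (1 / (B.dim : ℂ)) • measPrep (phaseOp A s.1) (phaseOp B r.2) := by
  rw [phaseOp_tensor]
  refine (contractRef_exchangeMap _ _ _ _).trans ?_
  rw [trace_phaseOp, trace_phaseOp, one_mul]
  rfl

lemma wignerMap_smul {A B : QSys} (c : ℂ) (Φ : QMap A B) (v : B.Phase) (u : A.Phase) :
    wignerMap (c • Φ) v u = c * wignerMap Φ v u := by
  simp only [wignerMap, LinearMap.smul_apply, Matrix.mul_smul, Matrix.trace_smul, smul_eq_mul]
  ring

lemma wignerMap_measPrep_phaseOp_nonneg {A B : QSys} (a u : A.Phase) (b v : B.Phase) :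
    0 ≤ wignerMap (measPrep (phaseOp A a) (phaseOp B b)) v u := by
  rw [wignerMap, measPrep_apply, Matrix.mul_smul, Matrix.trace_smul]
  exact mul_nonneg (one_div_dim_pos B).le
    (mul_nonneg (trace_phaseOp_mul_phaseOp_nonneg A a u) (trace_phaseOp_mul_phaseOp_nonneg B v b))

lemma isCPWP_exchangeMap (A B : QSys) :
    IsCPWP (A := (A.tensor B).tensor A) (B := (A.tensor B).tensor B)
      (exchangeMap A.Idx B.Idx) := by
  refine IsChannel.isCPWP_of_wignerMap_nonneg (isChannel_exchangeMap (α := A.Idx) (β := B.Idx)) ?_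
  rintro ⟨s, v⟩ ⟨r, u⟩
  refine le_of_le_of_eq ?_ (wignerMap_tensor (A.tensor B) (exchangeMap A.Idx B.Idx) r s v u).symm
  rw [contractRef_phaseOp_exchangeMap, wignerMap_smul]
  exact mul_nonneg (one_div_dim_pos _).le
    (mul_nonneg (one_div_dim_pos B).le (wignerMap_measPrep_phaseOp_nonneg _ _ _ _))

/-! ### Transition maps -/

/-- The map `X ↦ W_X(u) A_v`, whose discrete Wigner function is concentrated on the transition from
`u` to `v`. -/
def transitionMap {A B : QSys} (v : B.Phase) (u : A.Phase) : QMap A B :=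
  (1 / (A.dim : ℂ)) • measPrep (phaseOp A u) (phaseOp B v)

lemma transitionMap_apply {A B : QSys} (v : B.Phase) (u : A.Phase) (X : A.Op) :
    transitionMap v u X = wigner A X u • phaseOp B v :=
  smul_smul (1 / (A.dim : ℂ)) (phaseOp A u * X).trace (phaseOp B v)

theorem IsCPWPSuperchannel.wignerMap_transitionMap_nonneg {A B C D : QSys}
    {Ξ : QSuperMap A B C D} (hΞ : IsCPWPSuperchannel Ξ) (v : B.Phase) (u : A.Phase) (t : D.Phase)
    (w : C.Phase) : 0 ≤ wignerMap (Ξ (transitionMap v u)) t w := by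
  let r : (A.tensor B).Phase := (u, v)
  have hexchange := (hΞ.2 (A.tensor B) (exchangeMap A.Idx B.Idx)
    (isChannel_exchangeMap (α := A.Idx) (β := B.Idx)) (isCPWP_exchangeMap A B)).wignerMap_nonneg
      (r, t) (r, w)
  have hcond := nonneg_of_one_div_dim_mul_nonneg _
    (hexchange.trans_eq (wignerMap_refSuper (A.tensor B) Ξ (exchangeMap A.Idx B.Idx) r r t w))
  rw [contractRef_phaseOp_exchangeMap, map_smul, wignerMap_smul] at hcond
  rw [transitionMap, map_smul, wignerMap_smul]
  exact mul_nonneg (one_div_dim_pos A).le (nonneg_of_one_div_dim_mul_nonneg B hcond)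

lemma isTracePreserving_sum_transitionMap {A B : QSys} (f : A.Phase → B.Phase) :
    IsTracePreserving (∑ u, transitionMap (f u) u) := fun X => by
  simp only [LinearMap.sum_apply, transitionMap_apply, Matrix.trace_sum, Matrix.trace_smul,
    trace_phaseOp, smul_eq_mul, mul_one, sum_wigner]

lemma sum_wignerMap_smul_transitionMap {A B : QSys} (N : QMap A B) :
    ∑ u, ∑ v, wignerMap N v u • transitionMap v u = N := by
  ext1 X
  conv_rhs => rw [← sum_wigner_smul A X, map_sum]
  simp only [LinearMap.sum_apply, LinearMap.smul_apply, transitionMap_apply, map_smul]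
  refine Finset.sum_congr rfl fun u _ => ?_
  simp only [smul_comm _ (wigner A X u), ← Finset.smul_sum]
  exact congrArg _ (sum_wigner_smul B (N (phaseOp A u)))

lemma wignerMap_supermap {A B C D : QSys} (Ξ : QSuperMap A B C D) (N : QMap A B) (t : D.Phase)
    (w : C.Phase) : wignerMap (Ξ N) t w =
      ∑ u, ∑ v, wignerMap N v u * wignerMap (Ξ (transitionMap v u)) t w := by
  conv_lhs => rw [← sum_wignerMap_smul_transitionMap N]
  simp only [← wignerMap_smul, ← map_smul]
  simp only [wignerMap, map_sum, LinearMap.sum_apply, Matrix.trace_sum,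
    Finset.mul_sum]

lemma IsTracePreserving.sum_wignerMap {A B : QSys} {Φ : QMap A B} (hΦ : IsTracePreserving Φ)
    (u : A.Phase) : ∑ v, wignerMap Φ v u = 1 :=
  (sum_wigner B (Φ (phaseOp A u))).trans ((hΦ _).trans (trace_phaseOp A u))

lemma IsSuperchannel.sum_wignerMap_transitionMap {A B C D : QSys} {Ξ : QSuperMap A B C D}
    (hΞ : IsSuperchannel Ξ) (f : A.Phase → B.Phase) (w : C.Phase) :
    ∑ u, ∑ t, wignerMap (Ξ (transitionMap (f u) u)) t w = 1 := by
  have h := (hΞ.map_isTracePreserving (isTracePreserving_sum_transitionMap f)).sum_wignerMap w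
  rw [← h, Finset.sum_comm]
  simp only [wignerMap, map_sum, LinearMap.sum_apply, Matrix.trace_sum,
    Finset.mul_sum]

lemma sum_mul_le_mul_of_forall_sum_le {ι κ : Type*} [Fintype ι] [Fintype κ] [Nonempty κ]
    {a s : ι → κ → ℝ} {m c : ℝ} (ha : ∀ i k, 0 ≤ a i k) (hs : ∀ i k, 0 ≤ s i k) (hm : 0 ≤ m)
    (ham : ∀ i, ∑ k, a i k ≤ m) (hsc : ∀ f : ι → κ, ∑ i, s i (f i) ≤ c) :
    ∑ i, ∑ k, a i k * s i k ≤ m * c := by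
  choose f hf using fun i => Finite.exists_max (s i)
  calc ∑ i, ∑ k, a i k * s i k
      ≤ ∑ i, (∑ k, a i k) * s i (f i) := by
        simp only [Finset.sum_mul]
        gcongr with i _ k _
        exacts [ha i k, hf i k]
    _ ≤ ∑ i, m * s i (f i) := by
        gcongr with i _
        exacts [hs i _, ham i]
    _ ≤ m * c := by
        rw [← Finset.mul_sum]
        gcongr
        exact hsc f

theorem IsCPWPSuperchannel.sum_norm_wignerMap_le {A B C D : QSys} {Ξ : QSuperMap A B C D}
    (hΞ : IsCPWPSuperchannel Ξ) {N : QMap A B} {m : ℝ} (hm : ∀ u, ∑ v, ‖wignerMap N v u‖ ≤ m)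
    (w : C.Phase) : ∑ t, ‖wignerMap (Ξ N) t w‖ ≤ m := by
  let K (u : A.Phase) (v : B.Phase) : ℝ := ∑ t, ‖wignerMap (Ξ (transitionMap v u)) t w‖
  have hK (f : A.Phase → B.Phase) : ∑ u, K u (f u) = 1 := by
    have hnorm (u v t) := Complex.norm_of_nonneg' (hΞ.wignerMap_transitionMap_nonneg v u t w)
    refine Complex.ofReal_injective ?_
    simp only [K, Complex.ofReal_sum, hnorm, Complex.ofReal_one]
    exact hΞ.1.sum_wignerMap_transitionMap f w
  have hm0 : 0 ≤ m := (Finset.sum_nonneg fun _ _ => norm_nonneg _).trans (hm A.origin)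
  calc ∑ t, ‖wignerMap (Ξ N) t w‖
      ≤ ∑ t, ∑ u, ∑ v, ‖wignerMap N v u‖ * ‖wignerMap (Ξ (transitionMap v u)) t w‖ := by
        gcongr with t
        rw [wignerMap_supermap]
        refine (norm_sum_le _ _).trans (Finset.sum_le_sum fun u _ => ?_)
        exact (norm_sum_le _ _).trans_eq (Finset.sum_congr rfl fun v _ => norm_mul _ _)
    _ = ∑ u, ∑ v, ‖wignerMap N v u‖ * K u v := by
        simp only [K, Finset.mul_sum]
        rw [Finset.sum_comm]
        exact Finset.sum_congr rfl fun u _ => Finset.sum_comm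
    _ ≤ m * 1 := sum_mul_le_mul_of_forall_sum_le (fun _ _ => norm_nonneg _)
        (fun _ _ => Finset.sum_nonneg fun _ _ => norm_nonneg _) hm0 hm fun f => (hK f).le
    _ = m := mul_one m

end

theorem mainTheorem3_general {A B C D : QSys} {Ξ : QSuperMap A B C D}
    (hΞ : IsCPWPSuperchannel Ξ) (N : QMap A B) : mana (Ξ N) ≤ mana N := by
  refine ENNReal.log_monotone (ENNReal.ofReal_le_ofReal (ciSup_le ?_))
  exact hΞ.sum_norm_wignerMap_le (le_ciSup (Finite.bddAbove_range _))

theorem mainTheorem3 (A B C D : QSys) (Ξ : QSuperMap A B C D) (hΞ : IsCPWPSuperchannel Ξ)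
    (N : QMap A B) (hN : IsCompletelyPositive N) :
    mana (Ξ N) ≤ mana N :=
  mainTheorem3_general hΞ N
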